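/- Let $K\ge 2$ and consider a $K$-armed bandit whose arms all have the same reward distribution $\nu$, where $\nu$ is $1$-sub-Gaussian (that is, $\mathbb E\,e^{\lambda (X-\mathbb EX)}\le e^{\lambda^2/2}$ for all $\lambda\in\mathbb R$, $X\sim\nu$) and has positive variance; all rewards are independent. Write $n_{a,t}$ and $\widehat\mu_{a,t}$ for the number of pulls and the sample mean of arm $a$ after $t$ rounds. For every horizon $T$ let an optimism-based rule be given: it pulls each arm once in the first $K$ rounds, and afterwards $A_{t+1}\in\arg\max_{a}U_a(t)$, ties being broken uniformly at random, independently of everything else. The index $U_a(t)$ may depend on $T$. Assume that all arms are treated alike (relabelling the arms relabels the indices) and that, for every $T\ge1$, (A1) $U_a(t)$ is a (measurable) function of $(\widehat\mu_{b,t})_{b}$ and $(n_{b,t})_{b}$; (A2) if arm $a$ is not pulled in round $t$, where $K<t\le T$, then $U_a(t)\le U_a(t-1)$ (almost surely); (A3) almost surely on the event $\mathcal E_T=\{\,n_{a,\lfloor T/2K\rfloor}\in[\tfrac{T}{4K^2},\tfrac{3T}{4K^2}]\ \text{for all } a\,\}$ one has $$\widehat\mu_{a,t}+\frac{\beta_1}{\sqrt{n_{a,t}}}\le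 U_a(t)\le \widehat\mu_{a,t}+\frac{\beta_2}{\sqrt{n_{a,t}}}\qquad\text{for all arms } a \text{ and all } \lfloor T/2K\rfloor\le t\le T,$$ with real constants $\beta_1,\beta_2$ that do not depend on $T$. Say that the pull counts are (Lai–Wei) stable at times $\tau(T)$ if for every arm $a$ there are non-random $n^*_{a,T}\to\infty$ such that $n_{a,\tau(T)}/n^*_{a,T}\to1$ in probability as $T\to\infty$, where $n_{a,\tau(T)}$ is taken in the run with horizon $T$. Then the rule is unstable: 1. If the indices do not depend on the horizon $T$, the pull counts are not stable at times $T$. 2. For indices that may depend on the horizon, the pull counts are not stable both at times $\lfloor T/2K\rfloor$ and at times $T$. 3. If the pull counts are stable at times $\lfloor T/2K\rfloor$, then for each arm $a$ there is $p>0$ such that, for all large $T$, with probability at least $p$ arm $a$ is pulled in every round $t$ with $\lfloor T/2K\rfloor<t\le T$. -/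

import Mathlib

open MeasureTheory ProbabilityTheory Filter Topology
open scoped ENNReal NNReal

namespace Bandit

/-- An index rule for `K` arms: from the vector of sample means and the vector of pull counts it
computes the index `U_a` of every arm `a`. The current time is the sum of the counts, so an index
may depend on time as well. -/
abbrev IndexRule (K : ℕ) : Type := (Fin K → ℝ) → (Fin K → ℕ) → Fin K → ℝ

/-- The indices are measurable functions of the sample means. -/
def IsMeasurableRule {K : ℕ} (U : IndexRule K) : Prop :=
  ∀ (n : Fin K → ℕ) (a : Fin K), Measurable fun m : Fin K → ℝ => U m n a

/-- The rule treats all arms alike: relabelling the arms relabels the indices. -/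
def IsSymmetricRule {K : ℕ} (U : IndexRule K) : Prop :=
  ∀ (σ : Equiv.Perm (Fin K)) (m : Fin K → ℝ) (n : Fin K → ℕ) (a : Fin K),
    U (m ∘ σ) (n ∘ σ) a = U m n (σ a)

/-- The average of the first `n` entries of a reward sequence. -/
noncomputable def sampleMean (x : ℕ → ℝ) (n : ℕ) : ℝ :=
  (∑ i ∈ Finset.range n, x i) / n

open Classical in
/-- The set of arms of maximal index. -/
noncomputable def argmaxSet {K : ℕ} (u : Fin K → ℝ) : Finset (Fin K) :=
  Finset.univ.filter fun a => ∀ b, u b ≤ u a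

theorem argmaxSet_nonempty {K : ℕ} [NeZero K] (u : Fin K → ℝ) : (argmaxSet u).Nonempty := by
  obtain ⟨a, ha⟩ := Finite.exists_max u
  exact ⟨a, by simpa [argmaxSet] using ha⟩

/-- The arm of maximal index whose rank `r a` is smallest. For a uniformly random ranking `r` this
is a uniformly random element of the argmax. -/
noncomputable def pick {K : ℕ} [NeZero K] (u : Fin K → ℝ) (r : Equiv.Perm (Fin K)) : Fin K :=
  r.symm (((argmaxSet u).map r.toEmbedding).min' ((argmaxSet_nonempty u).map))

/-- The arm pulled in round `t + 1`, when `n` is the vector of pull counts after `t` rounds, `x a i`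
is the reward returned by the `(i+1)`-st pull of arm `a`, and `r` is the ranking that breaks ties.
The first `K` rounds pull each arm once; every later round pulls an arm of maximal index. -/
noncomputable def nextArm {K : ℕ} [NeZero K] (U : IndexRule K) (x : Fin K → ℕ → ℝ)
    (r : Equiv.Perm (Fin K)) (t : ℕ) (n : Fin K → ℕ) : Fin K :=
  if h : t < K then ⟨t, h⟩ else pick (U (fun a => sampleMean (x a) (n a)) n) r

/-- The vector of pull counts `n_{a,t}` after `t` rounds. -/
noncomputable def counts {K : ℕ} [NeZero K] (U : IndexRule K) (x : Fin K → ℕ → ℝ)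
    (r : ℕ → Equiv.Perm (Fin K)) : ℕ → Fin K → ℕ
  | 0 => fun _ => 0
  | t + 1 => fun a =>
      counts U x r t a + if nextArm U x (r t) t (counts U x r t) = a then 1 else 0

/-- The arm pulled in round `t + 1`. -/
noncomputable def action {K : ℕ} [NeZero K] (U : IndexRule K) (x : Fin K → ℕ → ℝ)
    (r : ℕ → Equiv.Perm (Fin K)) (t : ℕ) : Fin K :=
  nextArm U x (r t) t (counts U x r t)

/-- The sample mean of arm `a` after `t` rounds. -/
noncomputable def armMean {K : ℕ} [NeZero K] (U : IndexRule K) (x : Fin K → ℕ → ℝ)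
    (r : ℕ → Equiv.Perm (Fin K)) (t : ℕ) (a : Fin K) : ℝ :=
  sampleMean (x a) (counts U x r t a)

/-- The index `U_a(t)` of arm `a` after `t` rounds. -/
noncomputable def armIndex {K : ℕ} [NeZero K] (U : IndexRule K) (x : Fin K → ℕ → ℝ)
    (r : ℕ → Equiv.Perm (Fin K)) (t : ℕ) (a : Fin K) : ℝ :=
  U (armMean U x r t) (counts U x r t) a

instance instMeasurableSpacePerm (K : ℕ) : MeasurableSpace (Equiv.Perm (Fin K)) := ⊤

/-- A `K`-armed bandit environment whose arms all have reward distribution `ν`: `X a i` is the reward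
of the `(i+1)`-st pull of arm `a`, and `ρ t` is the ranking of the arms that breaks ties after `t`
rounds. All rewards have law `ν`, all rankings are uniform, and everything is independent. -/
structure IsEnvironment {Ω : Type*} [MeasurableSpace Ω] {K : ℕ} (P : Measure Ω) (ν : Measure ℝ)
    (X : Fin K → ℕ → Ω → ℝ) (ρ : ℕ → Ω → Equiv.Perm (Fin K)) : Prop where
  measurable_reward : ∀ a i, Measurable (X a i)
  law_reward : ∀ a i, P.map (X a i) = ν
  indep_reward : iIndepFun (fun (p : Fin K × ℕ) ω => X p.1 p.2 ω) P
  measurable_rank : ∀ t, Measurable (ρ t)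
  law_rank : ∀ t, P.map (ρ t) = (PMF.uniformOfFintype (Equiv.Perm (Fin K))).toMeasure
  indep_rank : iIndepFun ρ P
  indep_reward_rank :
    IndepFun (fun ω (p : Fin K × ℕ) => X p.1 p.2 ω) (fun ω t => ρ t ω) P

/-- The rewards and the tie-breaking rankings of the outcome `ω`. -/
def rewardTable {Ω : Type*} {K : ℕ} (X : Fin K → ℕ → Ω → ℝ) (ω : Ω) : Fin K → ℕ → ℝ :=
  fun a i => X a i ω

/-- The number of pulls of arm `a` after `t` rounds, as a random variable. -/
noncomputable def pulls {Ω : Type*} {K : ℕ} [NeZero K] (U : IndexRule K)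
    (X : Fin K → ℕ → Ω → ℝ) (ρ : ℕ → Ω → Equiv.Perm (Fin K)) (t : ℕ) (a : Fin K) (ω : Ω) : ℕ :=
  counts U (rewardTable X ω) (fun s => ρ s ω) t a

/-- The arm pulled in round `t + 1`, as a random variable. -/
noncomputable def arm {Ω : Type*} {K : ℕ} [NeZero K] (U : IndexRule K)
    (X : Fin K → ℕ → Ω → ℝ) (ρ : ℕ → Ω → Equiv.Perm (Fin K)) (t : ℕ) (ω : Ω) : Fin K :=
  action U (rewardTable X ω) (fun s => ρ s ω) t

/-- The sample mean of arm `a` after `t` rounds, as a random variable. -/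
noncomputable def mean {Ω : Type*} {K : ℕ} [NeZero K] (U : IndexRule K)
    (X : Fin K → ℕ → Ω → ℝ) (ρ : ℕ → Ω → Equiv.Perm (Fin K)) (t : ℕ) (a : Fin K) (ω : Ω) : ℝ :=
  armMean U (rewardTable X ω) (fun s => ρ s ω) t a

/-- The index `U_a(t)` of arm `a` after `t` rounds, as a random variable. -/
noncomputable def index {Ω : Type*} {K : ℕ} [NeZero K] (U : IndexRule K)
    (X : Fin K → ℕ → Ω → ℝ) (ρ : ℕ → Ω → Equiv.Perm (Fin K)) (t : ℕ) (a : Fin K) (ω : Ω) : ℝ :=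
  armIndex U (rewardTable X ω) (fun s => ρ s ω) t a

/-- In the run with horizon `T`, the index of an arm does not increase in a round in which the arm
is not pulled. Indices exist from time `K` on, when every arm has been pulled once. -/
def IndexNonincreasing {Ω : Type*} [MeasurableSpace Ω] {K : ℕ} [NeZero K] (P : Measure Ω)
    (U : IndexRule K) (X : Fin K → ℕ → Ω → ℝ) (ρ : ℕ → Ω → Equiv.Perm (Fin K)) (T : ℕ) : Prop :=
  ∀ᵐ ω ∂P, ∀ t, K ≤ t → t < T → ∀ a, arm U X ρ t ω ≠ a →
    index U X ρ (t + 1) a ω ≤ index U X ρ t a ω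

/-- The event that after `⌊T / (2K)⌋` rounds every arm has been pulled between `T / (4K²)` and
`3T / (4K²)` times. -/
def balancedEvent {Ω : Type*} {K : ℕ} [NeZero K] (U : IndexRule K)
    (X : Fin K → ℕ → Ω → ℝ) (ρ : ℕ → Ω → Equiv.Perm (Fin K)) (T : ℕ) : Set Ω :=
  {ω | ∀ a, (pulls U X ρ (T / (2 * K)) a ω : ℝ) ∈
    Set.Icc ((T : ℝ) / (4 * (K : ℝ) ^ 2)) (3 * (T : ℝ) / (4 * (K : ℝ) ^ 2))}

/-- In the run with horizon `T`, on the balanced event, all indices from time `⌊T / (2K)⌋` on lie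
between two indices with constant bonus factors `β₁` and `β₂`. -/
def IndexSandwiched {Ω : Type*} [MeasurableSpace Ω] {K : ℕ} [NeZero K] (P : Measure Ω)
    (U : IndexRule K) (X : Fin K → ℕ → Ω → ℝ) (ρ : ℕ → Ω → Equiv.Perm (Fin K))
    (β₁ β₂ : ℝ) (T : ℕ) : Prop :=
  ∀ᵐ ω ∂P, ω ∈ balancedEvent U X ρ T → ∀ t, T / (2 * K) ≤ t → t ≤ T → ∀ a,
    mean U X ρ t a ω + β₁ / √(pulls U X ρ t a ω) ≤ index U X ρ t a ω ∧
    index U X ρ t a ω ≤ mean U X ρ t a ω + β₂ / √(pulls U X ρ t a ω)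

/-- Lai–Wei stability of the pull counts of the horizon-`T` runs of the rules `U T`, observed at time
`τ T`: there are non-random `n*_{a,T} → ∞` with `n_{a,τ(T)} / n*_{a,T} → 1` in probability. The case
`τ T = T` is stability at the horizon. -/
def StableAt {Ω : Type*} [MeasurableSpace Ω] {K : ℕ} [NeZero K] (P : Measure Ω)
    (U : ℕ → IndexRule K) (X : Fin K → ℕ → Ω → ℝ) (ρ : ℕ → Ω → Equiv.Perm (Fin K))
    (τ : ℕ → ℕ) : Prop :=
  ∀ a : Fin K, ∃ nstar : ℕ → ℝ,
    TendstoInMeasure P (fun T ω => (pulls (U T) X ρ (τ T) a ω : ℝ) / nstar T) atTop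
      (fun _ => (1 : ℝ)) ∧
    Tendsto nstar atTop atTop

end Bandit

/-! Luck in the rewards is of the same order as the bonuses, so it can decide the run. Suppose all
arms have been pulled a constant fraction of `T` times by time `T / (2 * K)`. From then on every
bonus is `O(1 / √T)`. With probability bounded away from zero, one chosen arm has sample means
exceeding the true mean by a large multiple of `1 / √T` at all counts it can still reach, while no
other arm is above the true mean. The chosen arm then has the largest index. The other indices
cannot grow while their arms are idle, so this arm is pulled until `T` (`action_eq_of_sum_bounds`).

Rewards are tabulated by pull number, so the luck is an event about independent random walks at
deterministic times `n ∈ [m, A * m]`, and adaptive sampling plays no role. The central limit theorem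
provides the initial excess and a maximal inequality preserves it
(`exists_pos_le_measureReal_forall_le_sum`).

Exchangeability of the arms turns stability into balance: every count is close to the average
(`StableAt.tendsto_measure_unbalanced`). Stability at the early time thus makes lock-in possible,
and lock-in breaks balance at time `T`. Without dependence on the horizon, stability at times `T`
already includes stability at the early times (`StableAt.comp`). -/

namespace ProbabilityTheory

/-! ### Random walks: maximal inequality and persistence above a square-root level. -/

variable {Ω : Type*} [MeasurableSpace Ω] {P : Measure Ω} [IsProbabilityMeasure P] {Y : ℕ → Ω → ℝ}

/-- The partial sums of independent centered random variables form a martingale. -/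
theorem martingale_sum_range_succ (hY : ∀ i, StronglyMeasurable (Y i))
    (hint : ∀ i, Integrable (Y i) P) (hindep : iIndepFun Y P) (hzero : ∀ i, ∫ ω, Y i ω ∂P = 0) :
    Martingale (fun n ω => ∑ i ∈ Finset.range (n + 1), Y i ω) (Filtration.natural Y hY) P := by
  refine martingale_of_condExp_sub_eq_zero_nat (fun n => ?_)
    (fun n => integrable_finsetSum _ fun i _ => hint i) fun n => ?_
  · refine Finset.stronglyMeasurable_fun_sum _ fun i hi => ?_
    exact (Filtration.stronglyAdapted_natural hY i).mono
      ((Filtration.natural Y hY).mono (Nat.lt_succ_iff.1 (Finset.mem_range.1 hi)))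
  · have h : ((fun ω => ∑ i ∈ Finset.range (n + 1 + 1), Y i ω) -
        fun ω => ∑ i ∈ Finset.range (n + 1), Y i ω) = Y (n + 1) := by
      funext ω
      simp [Finset.sum_range_succ _ (n + 1)]
    rw [h]
    filter_upwards [hindep.condExp_natural_ae_eq_of_lt hY (Nat.lt_succ_self n)] with ω hω
    simpa [hzero] using hω

/-- The first absolute moment of a sum of `n` independent centered random variables of
variance `v`. -/
theorem integral_abs_sum_le_sqrt {v : ℝ} (hL2 : ∀ i, MemLp (Y i) 2 P) (hindep : iIndepFun Y P)
    (hzero : ∀ i, ∫ ω, Y i ω ∂P = 0) (hv : ∀ i, Var[Y i; P] = v) (n : ℕ) :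
    ∫ ω, |∑ i ∈ Finset.range n, Y i ω| ∂P ≤ √(n * v) := by
  have hS : MemLp (fun ω => ∑ i ∈ Finset.range n, Y i ω) 2 P :=
    memLp_finsetSum _ fun i _ => hL2 i
  have hvar : Var[fun ω => ∑ i ∈ Finset.range n, Y i ω; P] = n * v := by
    have := IndepFun.variance_sum (X := Y) (s := Finset.range n) (fun i _ => hL2 i)
      (fun i _ j _ hij => hindep.indepFun hij)
    simp only [hv, Finset.sum_const, Finset.card_range, nsmul_eq_mul] at this
    rw [← this]
    congr 1
    funext ω
    simp
  have hmean : ∫ ω, ∑ i ∈ Finset.range n, Y i ω ∂P = 0 := by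
    rw [integral_finsetSum _ fun i _ => (hL2 i).integrable (by norm_num)]
    simp [hzero]
  have habs : MemLp (fun ω => |∑ i ∈ Finset.range n, Y i ω|) 2 P := hS.abs
  have h1 := variance_eq_sub hS
  have h2 := variance_eq_sub habs
  -- Nonnegativity of the variance of `|S|` is the bound `(E|S|)² ≤ E S²`.
  have h3 := variance_nonneg (fun ω => |∑ i ∈ Finset.range n, Y i ω|) P
  rw [hvar, hmean] at h1
  rw [h2] at h3
  simp only [Pi.pow_def, sq_abs] at h1 h3
  apply Real.le_sqrt_of_sq_le
  linarith

/-- A maximal inequality for sums of independent centered random variables. -/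
theorem measureReal_exists_le_abs_sum_le {v : ℝ} (hY : ∀ i, Measurable (Y i))
    (hL2 : ∀ i, MemLp (Y i) 2 P) (hindep : iIndepFun Y P)
    (hzero : ∀ i, ∫ ω, Y i ω ∂P = 0) (hv : ∀ i, Var[Y i; P] = v) (n : ℕ) {d : ℝ} (hd : 0 < d) :
    P.real {ω | ∃ k ≤ n, d ≤ |∑ i ∈ Finset.range k, Y i ω|} ≤ √(n * v) / d := by
  obtain _ | n := n
  · simp [hd.not_ge]
  have hmart := martingale_sum_range_succ (fun i => (hY i).stronglyMeasurable)
    (fun i => (hL2 i).integrable (by norm_num)) hindep hzero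
  -- `|S|` is the supremum of the martingales `S` and `-S`.
  have hsub : Submartingale (fun n ω => |∑ i ∈ Finset.range (n + 1), Y i ω|)
      (Filtration.natural Y fun i => (hY i).stronglyMeasurable) P :=
    hmart.submartingale.sup hmart.neg.submartingale
  have hmax := maximal_ineq hsub (fun _ _ => abs_nonneg _) (ε := ⟨d, hd.le⟩) n
  set A := {ω | d ≤ (Finset.range (n + 1)).sup' Finset.nonempty_range_add_one
    fun k => |∑ i ∈ Finset.range (k + 1), Y i ω|} with hA
  have hset : {ω | ∃ k ≤ n + 1, d ≤ |∑ i ∈ Finset.range k, Y i ω|} ⊆ A := by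
    rintro ω ⟨k, hk, hdk⟩
    obtain _ | k := k
    · simp at hdk; linarith
    · simp only [hA, Set.mem_ofPred_eq, Finset.le_sup'_iff, Finset.mem_range]
      exact ⟨k, by omega, hdk⟩
  have hint : Integrable (fun ω => |∑ i ∈ Finset.range (n + 1), Y i ω|) P := hsub.integrable n
  have hbound : ∫ ω in A, |∑ i ∈ Finset.range (n + 1), Y i ω| ∂P ≤ √((n + 1 : ℕ) * v) :=
    (setIntegral_le_integral hint (ae_of_all _ fun _ => abs_nonneg _)).trans
      (integral_abs_sum_le_sqrt hL2 hindep hzero hv _)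
  have hreal : d * P.real A ≤ √((n + 1 : ℕ) * v) := by
    have := ENNReal.toReal_mono ENNReal.ofReal_ne_top hmax
    rw [ENNReal.toReal_mul, ENNReal.toReal_ofReal (integral_nonneg fun _ => abs_nonneg _)] at this
    exact le_trans this hbound
  rw [le_div_iff₀ hd, mul_comm]
  exact (mul_le_mul_of_nonneg_left (measureReal_mono hset) hd.le).trans hreal

/-- By the central limit theorem, the sum of `n` i.i.d. centered random variables of positive
variance exceeds `c * √n` with probability bounded away from zero. -/
theorem exists_pos_le_measureReal_lt_sum (hL2 : MemLp (Y 0) 2 P) (hindep : iIndepFun Y P)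
    (hident : ∀ i, IdentDistrib (Y i) (Y 0) P P) (hzero : ∫ ω, Y 0 ω ∂P = 0)
    (hvar : 0 < Var[Y 0; P]) (c : ℝ) :
    ∃ p : ℝ, 0 < p ∧ ∀ᶠ n : ℕ in atTop,
      p ≤ P.real {ω | c * √n < ∑ i ∈ Finset.range n, Y i ω} := by
  set γ := gaussianReal 0 Var[Y 0; P].toNNReal
  have hne : Var[Y 0; P].toNNReal ≠ 0 := by simpa using hvar
  have hclt := tendstoInDistribution_inv_sqrt_mul_sum_sub (Y := id) (P' := γ)
    ⟨aemeasurable_id, Measure.map_id⟩ hL2 hindep hident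
  -- Portmanteau for an open half-line: the limiting Gaussian mass bounds the liminf from below.
  have hopen := ProbabilityMeasure.le_liminf_measure_open_of_tendsto hclt.tendsto
    (isOpen_Ioi (a := c))
  simp only [ProbabilityMeasure.coe_mk, Measure.map_id, hzero, mul_zero, sub_zero] at hopen
  have hpos : 0 < γ (Set.Ioi c) := by
    have := (gaussianReal_absolutelyContinuous' 0 hne).isOpenPosMeasure
    exact isOpen_Ioi.measure_pos γ Set.nonempty_Ioi
  obtain ⟨p, hp0, hp⟩ := exists_between (hpos.trans_le hopen)
  have hptop : p ≠ ∞ := by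
    rintro rfl
    exact absurd hp (by simp)
  refine ⟨p.toReal, ENNReal.toReal_pos hp0.ne' hptop, ?_⟩
  filter_upwards [eventually_lt_of_lt_liminf hp, eventually_gt_atTop 0] with n hn hn0
  refine ENNReal.toReal_mono (measure_ne_top _ _) (hn.le.trans ?_)
  have hm : AEMeasurable (fun ω => (√(n : ℝ))⁻¹ * ∑ i ∈ Finset.range n, Y i ω) P := by
    have := fun i => (hident i).aemeasurable_fst
    fun_prop
  rw [Measure.map_apply_of_aemeasurable hm measurableSet_Ioi]
  refine measure_mono fun ω hω => ?_
  have hs : 0 < √(n : ℝ) := Real.sqrt_pos.2 (by exact_mod_cast hn0)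
  simp only [Set.mem_preimage, Set.mem_Ioi, inv_mul_eq_div] at hω
  exact (lt_div_iff₀ hs).1 hω

/-- A centered i.i.d. random walk of positive variance stays above the level `c * √m` during the
whole period from `m` to `A * m` with probability bounded away from zero. -/
theorem exists_pos_le_measureReal_forall_le_sum (hY : ∀ i, Measurable (Y i))
    (hL2 : MemLp (Y 0) 2 P) (hindep : iIndepFun Y P)
    (hident : ∀ i, IdentDistrib (Y i) (Y 0) P P) (hzero : ∫ ω, Y 0 ω ∂P = 0)
    (hvar : 0 < Var[Y 0; P]) (c : ℝ) (A : ℕ) :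
    ∃ p : ℝ, 0 < p ∧ ∀ᶠ m : ℕ in atTop,
      p ≤ P.real {ω | ∀ n ∈ Finset.Icc m (A * m), c * √m ≤ ∑ i ∈ Finset.range n, Y i ω} := by
  set v := Var[Y 0; P] with hv_def
  have hL2' : ∀ i, MemLp (Y i) 2 P := fun i => (hident i).memLp_iff.2 hL2
  have hzero' : ∀ i, ∫ ω, Y i ω ∂P = 0 := fun i => (hident i).integral_eq.trans hzero
  have hv' : ∀ i, Var[Y i; P] = v := fun i => (hident i).variance_eq
  -- The maximal inequality over `A * m` steps gives `√(A * v) / d ≤ 1 / 2`; the `+ 1` keeps `d`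
  -- positive when `A = 0`. Starting above `c + d` at time `m`, the walk can then afford to lose
  -- `d`.
  set d := 2 * √(A * v) + 1 with hd
  have hd0 : 0 < d := by positivity
  obtain ⟨p, hp, hev⟩ := exists_pos_le_measureReal_lt_sum hL2 hindep hident hzero hvar (c + d)
  refine ⟨p / 2, by positivity, ?_⟩
  filter_upwards [hev, eventually_gt_atTop 0] with m hm hm0
  have hs : 0 < √(m : ℝ) := Real.sqrt_pos.2 (by exact_mod_cast hm0)
  set B : Set Ω := {ω | ∃ k ≤ A * m, d * √m ≤ |∑ i ∈ Finset.range k, Y (m + i) ω|}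
  set C : Set Ω := {ω | (c + d) * √m < ∑ i ∈ Finset.range m, Y i ω}
  have hB : P.real B ≤ 1 / 2 := by
    refine (measureReal_exists_le_abs_sum_le (fun i => hY (m + i)) (fun i => hL2' _)
      (hindep.precomp (add_right_injective m)) (fun i => hzero' _) (fun i => hv' _) (A * m)
      (by positivity)).trans ?_
    rw [div_le_div_iff₀ (by positivity) (by norm_num), Nat.cast_mul, mul_right_comm,
      Real.sqrt_mul (by positivity)]
    nlinarith
  have hBm : MeasurableSet B := by
    simp only [B, Set.ofPred_exists, Set.ofPred_and]
    refine MeasurableSet.iUnion fun k => (MeasurableSet.const _).inter ?_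
    exact measurableSet_le measurable_const (by fun_prop)
  have hindepBC : P.real (C ∩ Bᶜ) = P.real C * P.real Bᶜ := by
    have hdisj : Disjoint (Finset.range m) (Finset.Ico m (m + A * m)) := by
      rw [Finset.disjoint_left]
      simp
      omega
    have h := hindep.indepFun_finset _ _ hdisj hY
    have hC' : C = (fun ω (i : Finset.range m) => Y i ω) ⁻¹'
        {x | (c + d) * √m < ∑ i : Finset.range m, x i} := by
      ext ω
      simp only [C, Set.mem_ofPred_eq, Set.mem_preimage]
      rw [Finset.sum_coe_sort (Finset.range m) fun i => Y i ω]
    -- Independence of finite blocks needs an event in the window coordinates alone, so the partial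
    -- sums become full sums over the window with an indicator.
    have hB' : Bᶜ = (fun ω (i : Finset.Ico m (m + A * m)) => Y i ω) ⁻¹'
        {x | ∀ k ≤ A * m, |∑ i : Finset.Ico m (m + A * m), if (i : ℕ) < m + k then x i else 0|
          < d * √m} := by
      ext ω
      simp only [B, Set.mem_compl_iff, Set.mem_ofPred_eq, Set.mem_preimage, not_exists, not_and,
        not_le]
      refine forall₂_congr fun k hk => ?_
      rw [Finset.sum_coe_sort (Finset.Ico m (m + A * m))
        fun i => if i < m + k then Y i ω else 0, ← Finset.sum_filter]
      have : (Finset.Ico m (m + A * m)).filter (· < m + k) = Finset.Ico m (m + k) := by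
        ext i
        simp
        omega
      rw [this, Finset.sum_Ico_eq_sum_range]
      simp
    rw [hC', hB']
    have := h.measure_inter_preimage_eq_mul
      {x | (c + d) * √m < ∑ i : Finset.range m, x i}
      {x | ∀ k ≤ A * m, |∑ i : Finset.Ico m (m + A * m), if (i : ℕ) < m + k then x i else 0|
          < d * √m} (measurableSet_lt measurable_const (by fun_prop)) ?_
    · simp only [Measure.real, this, ENNReal.toReal_mul]
    · simp only [Set.ofPred_forall]
      refine MeasurableSet.iInter fun k => MeasurableSet.iInter fun _ =>
        measurableSet_lt ?_ measurable_const
      refine (Finset.measurable_fun_sum _ fun i _ => ?_).abs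
      split_ifs <;> fun_prop
  have hBc : 1 / 2 ≤ P.real Bᶜ := by
    rw [probReal_compl_eq_one_sub hBm]
    linarith
  calc p / 2 = p * (1 / 2) := by ring
    _ ≤ P.real C * P.real Bᶜ := by gcongr
    _ = P.real (C ∩ Bᶜ) := hindepBC.symm
    _ ≤ _ := measureReal_mono ?_
  rintro ω ⟨hωC, hωB⟩ n hn
  rw [Finset.mem_Icc] at hn
  simp only [B, C, Set.mem_compl_iff, Set.mem_ofPred_eq, not_exists, not_and, not_le] at hωC hωB
  have hω := hωB (n - m) (by omega)
  have hsplit : ∑ i ∈ Finset.range n, Y i ω =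
      ∑ i ∈ Finset.range m, Y i ω + ∑ i ∈ Finset.range (n - m), Y (m + i) ω := by
    rw [← Finset.sum_range_add, Nat.add_sub_cancel' hn.1]
  rw [abs_lt] at hω
  rw [hsplit]
  linarith [hω.1]

end ProbabilityTheory

/-! ### Pathwise dynamics of the rule: relabelling, lock-in, measurability. -/

namespace Bandit

section Deterministic

variable {K : ℕ} [NeZero K]

/-- Replaces the minimum over an image by order conditions, from which equivariance and
measurability of the choice can be read off. -/
theorem pick_eq_iff (u : Fin K → ℝ) (r : Equiv.Perm (Fin K)) (a : Fin K) :
    pick u r = a ↔ (∀ b, u b ≤ u a) ∧ ∀ b, (∀ c, u c ≤ u b) → r a ≤ r b := by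
  have hmem : ∀ b, b ∈ argmaxSet u ↔ ∀ c, u c ≤ u b := fun b => by simp [argmaxSet]
  have hmin : ∀ b, (∀ c, u c ≤ u b) → r (pick u r) ≤ r b := fun b hb => by
    rw [pick, Equiv.apply_symm_apply]
    exact Finset.min'_le _ _ (Finset.mem_map_of_mem _ ((hmem b).2 hb))
  have hmax : ∀ c, u c ≤ u (pick u r) := by
    obtain ⟨b, hb, hrb⟩ := Finset.mem_map.1 (Finset.min'_mem _ ((argmaxSet_nonempty u).map
      (f := r.toEmbedding)))
    have : pick u r = b := by
      rw [pick, ← hrb]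
      simp
    rw [this]
    exact (hmem b).1 hb
  refine ⟨by rintro rfl; exact ⟨hmax, hmin⟩, fun ⟨h1, h2⟩ => ?_⟩
  exact r.injective (le_antisymm (hmin a h1) (h2 _ hmax))

theorem pick_comp_perm (u : Fin K → ℝ) (r σ : Equiv.Perm (Fin K)) :
    σ (pick (u ∘ σ) (r * σ)) = pick u r := by
  symm
  obtain ⟨h1, h2⟩ := (pick_eq_iff (u ∘ σ) (r * σ) _).1 rfl
  refine (pick_eq_iff _ _ _).2 ⟨fun b => by simpa using h1 (σ.symm b), fun b hb => ?_⟩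
  simpa using h2 (σ.symm b) fun c => by simpa using hb (σ c)

/-- If one arm has a strictly larger index than all others, it is the one pulled. -/
theorem pick_eq_of_lt {u : Fin K → ℝ} (r : Equiv.Perm (Fin K)) {a : Fin K}
    (h : ∀ b, b ≠ a → u b < u a) : pick u r = a := by
  refine (pick_eq_iff _ _ _).2 ⟨fun b => ?_, fun b hb => ?_⟩
  · by_cases hba : b = a
    · rw [hba]
    · exact (h b hba).le
  · have : b = a := by
      by_contra hba
      exact absurd (hb a) (h b hba).not_ge
    rw [this]

variable (U : IndexRule K) (x : Fin K → ℕ → ℝ) (r : ℕ → Equiv.Perm (Fin K))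

theorem counts_succ (t : ℕ) (a : Fin K) :
    counts U x r (t + 1) a = counts U x r t a + if action U x r t = a then 1 else 0 := rfl

theorem sum_counts (t : ℕ) : ∑ a, counts U x r t a = t := by
  induction t with
  | zero => simp [counts]
  | succ t ih => simp [counts_succ, Finset.sum_add_distrib, ih]

theorem counts_le (t : ℕ) (a : Fin K) : counts U x r t a ≤ t :=
  (Finset.single_le_sum (fun _ _ => Nat.zero_le _) (Finset.mem_univ a)).trans
    (sum_counts U x r t).le

theorem counts_mono (a : Fin K) : Monotone fun t => counts U x r t a :=
  monotone_nat_of_le_succ fun t => by simp [counts_succ]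

theorem counts_of_le {t : ℕ} (ht : t ≤ K) (a : Fin K) :
    counts U x r t a = if (a : ℕ) < t then 1 else 0 := by
  induction t with
  | zero => simp [counts]
  | succ t ih =>
    have h : action U x r t = ⟨t, ht⟩ := by simp [action, nextArm, Nat.lt_of_succ_le ht]
    rw [counts_succ, ih (by omega), h]
    simp only [Fin.ext_iff]
    split_ifs <;> omega

variable {U}

/-- Relabelling the arms relabels the pull counts. -/
theorem counts_comp_perm (hU : IsSymmetricRule U) (σ : Equiv.Perm (Fin K)) {t : ℕ} (ht : K ≤ t) :
    counts U (x ∘ σ) (fun s => r s * σ) t = counts U x r t ∘ σ := by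
  induction t, ht using Nat.le_induction with
  -- The initial rounds pull the arms in a fixed order and are not equivariant; symmetry starts at
  -- time `K`, when all counts equal one.
  | base => funext a; simp [counts_of_le]
  | succ t ht ih =>
    have h : σ (action U (x ∘ σ) (fun s => r s * σ) t) = action U x r t := by
      simp only [action, nextArm, ht.not_gt, dif_neg, not_false_eq_true, ih]
      rw [← pick_comp_perm _ (r t) σ]
      congr 3
      funext a
      exact hU σ (fun a => sampleMean (x a) (counts U x r t a)) (counts U x r t) a
    funext a
    rw [Function.comp_apply, counts_succ, counts_succ, ih, ← h]
    simp [σ.injective.eq_iff]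

/-- An arm whose pulls leave the index above all indices of the other arms at the current time
keeps being pulled, if the indices of unpulled arms do not increase. -/
theorem action_eq_of_forall_lt {s T : ℕ} (hs : K ≤ s) {a : Fin K} {z : ℝ}
    (hmono : ∀ t, s ≤ t → t < T → ∀ b, action U x r t ≠ b →
      armIndex U x r (t + 1) b ≤ armIndex U x r t b)
    (hlow : ∀ t, s ≤ t → t < T → z < armIndex U x r t a)
    (hup : ∀ b, b ≠ a → armIndex U x r s b ≤ z) {t : ℕ} (hst : s ≤ t) (htT : t < T) :
    action U x r t = a := by
  -- Invariant: as long as only `a` is pulled, the competitors' indices stay below `z`.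
  have key : ∀ t, s ≤ t → t < T → ∀ b, b ≠ a → armIndex U x r t b ≤ z := by
    intro t hst
    induction t, hst using Nat.le_induction with
    | base => exact fun _ => hup
    | succ t hst ih =>
      intro htT b hb
      have hpull : action U x r t = a := by
        rw [action, nextArm, dif_neg (by omega)]
        exact pick_eq_of_lt _ fun c hc => (ih (by omega) c hc).trans_lt (hlow t hst (by omega))
      exact (hmono t hst (by omega) b (hpull ▸ hb.symm)).trans (ih (by omega) b hb)
  rw [action, nextArm, dif_neg (by omega)]
  exact pick_eq_of_lt _ fun c hc => (key t hst htT c hc).trans_lt (hlow t hst htT)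

theorem measurable_pick : Measurable fun p : (Fin K → ℝ) × Equiv.Perm (Fin K) => pick p.1 p.2 := by
  refine measurable_from_prod_countable_left fun r => measurable_to_countable' fun a => ?_
  have : (fun u : Fin K → ℝ => pick u r) ⁻¹' {a} =
      (⋂ b, {u | u b ≤ u a}) ∩ ⋂ b, {u | (∀ c, u c ≤ u b) → r a ≤ r b} := by
    ext u
    simp [pick_eq_iff]
  rw [this]
  refine (MeasurableSet.iInter fun b => measurableSet_le (by fun_prop) (by fun_prop)).inter
    (MeasurableSet.iInter fun b => ?_)
  by_cases h : r a ≤ r b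
  · simp [h]
  · simp only [h, imp_false, not_forall, not_le]
    rw [Set.ofPred_exists]
    exact MeasurableSet.iUnion fun c => measurableSet_lt (by fun_prop) (by fun_prop)

theorem measurable_counts (hU : IsMeasurableRule U) (t : ℕ) :
    Measurable fun p : (Fin K → ℕ → ℝ) × (ℕ → Equiv.Perm (Fin K)) => counts U p.1 p.2 t := by
  induction t with
  | zero => exact measurable_const
  | succ t ih =>
    -- The count vector is treated as a separate variable with countably many values; once it is
    -- fixed, the sample means are averages of fixed length.
    have hnext : Measurable fun q : ((Fin K → ℕ → ℝ) × (ℕ → Equiv.Perm (Fin K))) ×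
        (Fin K → ℕ) => nextArm U q.1.1 (q.1.2 t) t q.2 := by
      refine measurable_from_prod_countable_left fun n => ?_
      by_cases h : t < K
      · simp [nextArm, h]
      · simp only [nextArm, h, dif_neg, not_false_eq_true]
        refine measurable_pick.comp (Measurable.prodMk ?_ (by fun_prop))
        refine measurable_pi_lambda _ fun a => (hU n a).comp (measurable_pi_lambda _ fun b => ?_)
        unfold sampleMean
        fun_prop
    have hact : Measurable fun p : (Fin K → ℕ → ℝ) × (ℕ → Equiv.Perm (Fin K)) =>
        action U p.1 p.2 t := hnext.comp (measurable_id.prodMk ih)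
    refine measurable_pi_lambda _ fun a => ?_
    simp only [counts_succ]
    exact ((measurable_pi_apply a).comp ih).add (Measurable.ite (hact (measurableSet_singleton a))
      measurable_const measurable_const)

end Deterministic

/-! ### Exchangeability of the arms. -/

section Exchangeability

variable {Ω : Type*} [MeasurableSpace Ω] {P : Measure Ω} {K : ℕ} {ν : Measure ℝ}
  {X : Fin K → ℕ → Ω → ℝ} {ρ : ℕ → Ω → Equiv.Perm (Fin K)}

/-- Right translation is a bijection of the group, so relabelling the arms leaves the tie-breaking
law unchanged. -/
theorem map_mul_right_uniformOfFintype (σ : Equiv.Perm (Fin K)) :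
    (PMF.uniformOfFintype (Equiv.Perm (Fin K))).toMeasure.map (fun r => r * σ) =
      (PMF.uniformOfFintype (Equiv.Perm (Fin K))).toMeasure := by
  refine Measure.ext_of_singleton fun r => ?_
  rw [Measure.map_apply measurable_from_top (MeasurableSet.of_discrete)]
  have : (fun s : Equiv.Perm (Fin K) => s * σ) ⁻¹' {r} = {r * σ⁻¹} := by
    ext s
    simp [eq_mul_inv_iff_mul_eq]
  rw [this, PMF.toMeasure_apply_singleton _ _ (.of_discrete),
    PMF.toMeasure_apply_singleton _ _ (.of_discrete)]
  simp

/-- Relabelling the arms does not change the joint law of the rewards and the rankings. -/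
theorem IsEnvironment.map_perm_eq [IsProbabilityMeasure P] (henv : IsEnvironment P ν X ρ)
    (σ : Equiv.Perm (Fin K)) :
    P.map (fun ω => (rewardTable X ω ∘ σ, fun s => ρ s ω * σ)) =
      P.map (fun ω => (rewardTable X ω, fun s => ρ s ω)) := by
  have hX := henv.measurable_reward
  have hρ := henv.measurable_rank
  have hflat : Measurable fun (x : Fin K × ℕ → ℝ) (a : Fin K) (i : ℕ) => x (a, i) := by fun_prop
  have hflatσ : Measurable fun (x : Fin K × ℕ → ℝ) (a : Fin K) (i : ℕ) => x (σ a, i) := by fun_prop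
  have hmul : Measurable fun (r : ℕ → Equiv.Perm (Fin K)) s => r s * σ :=
    measurable_pi_lambda _ fun s => (measurable_from_top (f := (· * σ))).comp (measurable_pi_apply s)
  have hXm : Measurable fun ω (p : Fin K × ℕ) => X p.1 p.2 ω := by fun_prop
  have hρm : Measurable fun ω t => ρ t ω := by fun_prop
  have hprod : P.map (fun ω => (rewardTable X ω, fun s => ρ s ω)) =
      (P.map (rewardTable X)).prod (P.map fun ω s => ρ s ω) :=
    (indepFun_iff_map_prod_eq_prod_map_map (hflat.comp hXm).aemeasurable hρm.aemeasurable).1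
      (henv.indep_reward_rank.comp hflat measurable_id)
  have hprodσ : P.map (fun ω => (rewardTable X ω ∘ σ, fun s => ρ s ω * σ)) =
      (P.map fun ω => rewardTable X ω ∘ σ).prod (P.map fun ω s => ρ s ω * σ) :=
    (indepFun_iff_map_prod_eq_prod_map_map (hflatσ.comp hXm).aemeasurable
      (hmul.comp hρm).aemeasurable).1 (henv.indep_reward_rank.comp hflatσ hmul)
  have hreward : P.map (fun ω => rewardTable X ω ∘ σ) = P.map (rewardTable X) := by
    have hinj : Function.Injective fun p : Fin K × ℕ => (σ p.1, p.2) := fun p q h => by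
      simpa [Prod.ext_iff] using h
    have h1 : P.map (fun ω (p : Fin K × ℕ) => X p.1 p.2 ω) =
        Measure.infinitePi fun p : Fin K × ℕ => P.map (X p.1 p.2) :=
      henv.indep_reward.map_fun_eq_infinitePi_map₀ hXm.aemeasurable
    have h2 : P.map (fun ω (p : Fin K × ℕ) => X (σ p.1) p.2 ω) =
        Measure.infinitePi fun p : Fin K × ℕ => P.map (X (σ p.1) p.2) :=
      (henv.indep_reward.precomp hinj).map_fun_eq_infinitePi_map₀
        (measurable_pi_lambda _ fun p => hX _ _).aemeasurable
    simp only [henv.law_reward] at h1 h2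
    have h3 := congrArg (Measure.map fun (x : Fin K × ℕ → ℝ) (a : Fin K) (i : ℕ) => x (a, i))
      (h2.trans h1.symm)
    rwa [Measure.map_map hflat (measurable_pi_lambda _ fun p => hX _ _),
      Measure.map_map hflat hXm] at h3
  have hrank : P.map (fun ω s => ρ s ω * σ) = P.map fun ω s => ρ s ω := by
    have hρσm : Measurable fun ω s => ρ s ω * σ := hmul.comp hρm
    have hcomp : iIndepFun (fun s ω => ρ s ω * σ) P :=
      henv.indep_rank.comp (fun _ r => r * σ) fun _ => measurable_from_top
    rw [henv.indep_rank.map_fun_eq_infinitePi_map₀ hρm.aemeasurable,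
      hcomp.map_fun_eq_infinitePi_map₀ hρσm.aemeasurable]
    congr 1
    funext s
    have : P.map (fun ω => ρ s ω * σ) = (P.map (ρ s)).map (fun r => r * σ) :=
      (Measure.map_map (g := (· * σ)) measurable_from_top (hρ s)).symm
    rw [this, henv.law_rank, map_mul_right_uniformOfFintype]
  rw [hprod, hprodσ, hreward, hrank]

/-- The pull counts of all arms have the same law. -/
theorem IsEnvironment.measure_pulls_eq [NeZero K] [IsProbabilityMeasure P]
    (henv : IsEnvironment P ν X ρ) {U : IndexRule K} (hmeas : IsMeasurableRule U)
    (hsymm : IsSymmetricRule U) {t : ℕ} (ht : K ≤ t) (a b : Fin K) (S : Set ℕ) :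
    P {ω | pulls U X ρ t a ω ∈ S} = P {ω | pulls U X ρ t b ω ∈ S} := by
  set σ := Equiv.swap b a
  have hX := henv.measurable_reward
  have hρ := henv.measurable_rank
  have hset : MeasurableSet {p : (Fin K → ℕ → ℝ) × (ℕ → Equiv.Perm (Fin K)) |
      counts U p.1 p.2 t b ∈ S} :=
    ((measurable_pi_apply b).comp (measurable_counts hmeas t)) (MeasurableSet.of_discrete (s := S))
  have h := congrArg (fun m => m {p : (Fin K → ℕ → ℝ) × (ℕ → Equiv.Perm (Fin K)) |
    counts U p.1 p.2 t b ∈ S}) (henv.map_perm_eq σ)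
  have hmul : Measurable fun (r : ℕ → Equiv.Perm (Fin K)) s => r s * σ :=
    measurable_pi_lambda _ fun s => (measurable_from_top (f := (· * σ))).comp (measurable_pi_apply s)
  have hρm : Measurable fun ω t => ρ t ω := by fun_prop
  beta_reduce at h
  have hpair : Measurable fun ω => (rewardTable X ω, fun s => ρ s ω) :=
    (measurable_pi_lambda _ fun a => measurable_pi_lambda _ fun i => hX a i).prodMk hρm
  have hpairσ : Measurable fun ω => (rewardTable X ω ∘ σ, fun s => ρ s ω * σ) :=
    (measurable_pi_lambda _ fun a => measurable_pi_lambda _ fun i => hX (σ a) i).prodMk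
      (hmul.comp hρm)
  rw [Measure.map_apply hpairσ hset, Measure.map_apply hpair hset] at h
  rw [Set.preimage_ofPred_eq, Set.preimage_ofPred_eq] at h
  simp only [counts_comp_perm _ _ hsymm σ ht] at h
  simpa [σ, pulls] using h

end Exchangeability

end Bandit

/-! ### Simultaneous luck of independent arms, balance from stability, and lock-in. -/

namespace Bandit

variable {Ω : Type*} [MeasurableSpace Ω] {P : Measure Ω} [IsProbabilityMeasure P] {K : ℕ}
  {ν : Measure ℝ} {X : Fin K → ℕ → Ω → ℝ} {ρ : ℕ → Ω → Equiv.Perm (Fin K)}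

/-- The reward sequences of the arms are independent. -/
theorem IsEnvironment.iIndepFun_rewardSeq (henv : IsEnvironment P ν X ρ) :
    iIndepFun (fun a ω i => X a i ω) P := by
  have hX := henv.measurable_reward
  have (a : Fin K) (i : ℕ) : IsProbabilityMeasure (P.map (X a i)) :=
    Measure.isProbabilityMeasure_map (hX a i).aemeasurable
  have hrow : ∀ a, P.map (fun ω i => X a i ω) = Measure.infinitePi fun i => P.map (X a i) :=
    fun a => (henv.indep_reward.precomp (g := fun i : ℕ => (a, i))
      (Prod.mk_right_injective a)).map_fun_eq_infinitePi_map fun i => hX a i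
  have hflat : P.map (fun ω (p : Fin K × ℕ) => X p.1 p.2 ω) =
      Measure.infinitePi fun p : Fin K × ℕ => P.map (X p.1 p.2) :=
    henv.indep_reward.map_fun_eq_infinitePi_map fun p => hX p.1 p.2
  rw [iIndepFun_iff_map_fun_eq_infinitePi_map fun a => measurable_pi_lambda _ (hX a)]
  simp only [hrow]
  rw [← Measure.infinitePi_map_curry fun a i => P.map (X a i),
    ← hflat, Measure.map_map (by fun_prop) (by fun_prop)]
  rfl

/-- With probability bounded away from zero, the centered and signed reward sums of all arms
simultaneously stay above prescribed levels of order `√m` during the period from `m` to `A * m`. -/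
theorem IsEnvironment.exists_pos_le_measureReal_forall_le_sum [IsProbabilityMeasure ν]
    (henv : IsEnvironment P ν X ρ)
    (hL2 : MemLp id 2 ν) (hvar : 0 < Var[id; ν]) {s : Fin K → ℝ} (hs : ∀ b, s b ≠ 0)
    (c : Fin K → ℝ) (A : ℕ) :
    ∃ p : ℝ, 0 < p ∧ ∀ᶠ m : ℕ in atTop, p ≤ P.real {ω | ∀ b, ∀ n ∈ Finset.Icc m (A * m),
      c b * √m ≤ ∑ i ∈ Finset.range n, s b * (X b i ω - ∫ y, y ∂ν)} := by
  have hX := henv.measurable_reward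
  set μ := ∫ y, y ∂ν
  have hg : ∀ b, Measurable fun y : ℝ => s b * (y - μ) := fun b => by fun_prop
  have hid : ∀ b i, IdentDistrib (X b i) id P ν := fun b i =>
    ⟨(hX b i).aemeasurable, aemeasurable_id, by rw [henv.law_reward, Measure.map_id]⟩
  have key : ∀ b, ∃ p : ℝ, 0 < p ∧ ∀ᶠ m : ℕ in atTop, p ≤ P.real {ω | ∀ n ∈ Finset.Icc m (A * m),
      c b * √m ≤ ∑ i ∈ Finset.range n, s b * (X b i ω - μ)} := by
    intro b
    have hidb := fun i => (hid b i).comp (hg b)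
    have hL2ν : MemLp (fun y : ℝ => s b * (y - μ)) 2 ν :=
      (hL2.sub (memLp_const μ)).const_mul (s b)
    refine ProbabilityTheory.exists_pos_le_measureReal_forall_le_sum
      (Y := fun i ω => s b * (X b i ω - μ)) (fun i => by fun_prop) ((hidb 0).memLp_iff.2 hL2ν) ?_
      (fun i => (hidb i).trans (hidb 0).symm) ?_ ?_ (c b) A
    · exact (henv.indep_reward.precomp (g := fun i : ℕ => (b, i))
        (Prod.mk_right_injective b)).comp (fun _ y => s b * (y - μ)) fun _ => hg b
    · refine (hidb 0).integral_eq.trans ?_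
      have : Integrable (fun y : ℝ => y) ν := hL2.integrable (by norm_num)
      simp only [Function.comp_def, id]
      rw [integral_const_mul, integral_sub this (integrable_const _)]
      simp [μ]
    · refine lt_of_lt_of_eq ?_ (hidb 0).variance_eq.symm
      simp only [Function.comp_def]
      rw [variance_const_mul, variance_sub_const (by fun_prop)]
      exact mul_pos (by have := hs b; positivity) hvar
  choose p hp hev using key
  refine ⟨∏ b, p b, Finset.prod_pos fun b _ => hp b, ?_⟩
  filter_upwards [eventually_all.2 hev] with m hm
  have hinter : P (⋂ b, {ω | ∀ n ∈ Finset.Icc m (A * m),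
      c b * √m ≤ ∑ i ∈ Finset.range n, s b * (X b i ω - μ)}) =
      ∏ b, P {ω | ∀ n ∈ Finset.Icc m (A * m),
        c b * √m ≤ ∑ i ∈ Finset.range n, s b * (X b i ω - μ)} := by
    refine henv.iIndepFun_rewardSeq.meas_iInter fun b => ⟨{x | ∀ n ∈ Finset.Icc m (A * m),
      c b * √m ≤ ∑ i ∈ Finset.range n, s b * (x i - μ)}, ?_, rfl⟩
    simp only [Set.ofPred_forall]
    exact MeasurableSet.iInter fun n => MeasurableSet.iInter fun _ =>
      measurableSet_le measurable_const (by fun_prop)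
  rw [Set.ofPred_forall, Measure.real, hinter, ENNReal.toReal_prod]
  exact Finset.prod_le_prod (fun b _ => (hp b).le) fun b _ => hm b

variable [NeZero K] {U : ℕ → IndexRule K}

/-- If the pull counts are stable, then with high probability all of them are within a third of
their average. -/
theorem StableAt.tendsto_measure_unbalanced (henv : IsEnvironment P ν X ρ)
    (hmeas : ∀ T, IsMeasurableRule (U T)) (hsymm : ∀ T, IsSymmetricRule (U T)) {τ : ℕ → ℕ}
    (hτ : ∀ᶠ T in atTop, K ≤ τ T) (h : StableAt P U X ρ τ) :
    Tendsto (fun T => P {ω | ∀ b, 2 / 3 * ((τ T : ℝ) / K) ≤ pulls (U T) X ρ (τ T) b ω ∧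
      pulls (U T) X ρ (τ T) b ω ≤ 4 / 3 * ((τ T : ℝ) / K)}ᶜ) atTop (𝓝 0) := by
  obtain ⟨nstar, hconv, hnstar⟩ := h 0
  -- If all counts lie within `1 / 10` of `nstar T` relatively, so does their average; their ratio
  -- to it is then between `9 / 11` and `11 / 9`, inside `[2 / 3, 4 / 3]`.
  have hlim := ENNReal.Tendsto.const_mul (a := (K : ℝ≥0∞))
    (tendstoInMeasure_iff_dist.1 hconv (1 / 10) (by norm_num)) (Or.inr (by simp))
  rw [mul_zero] at hlim
  refine tendsto_of_tendsto_of_tendsto_of_le_of_le' tendsto_const_nhds hlim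
    (Eventually.of_forall fun _ => zero_le) ?_
  filter_upwards [hτ, hnstar.eventually_gt_atTop 0] with T hKτ hpos
  -- Equal laws let the normalisation of arm `0` serve for all arms.
  have hlaw : ∀ b, P {ω | 1 / 10 ≤ dist ((pulls (U T) X ρ (τ T) b ω : ℝ) / nstar T) 1} =
      P {ω | 1 / 10 ≤ dist ((pulls (U T) X ρ (τ T) 0 ω : ℝ) / nstar T) 1} := fun b =>
    henv.measure_pulls_eq (hmeas T) (hsymm T) hKτ b 0
      {n | 1 / 10 ≤ dist ((n : ℝ) / nstar T) 1}
  calc P _ ≤ P (⋃ b, {ω | 1 / 10 ≤ dist ((pulls (U T) X ρ (τ T) b ω : ℝ) / nstar T) 1}) := ?_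
    _ ≤ ∑ b, P {ω | 1 / 10 ≤ dist ((pulls (U T) X ρ (τ T) b ω : ℝ) / nstar T) 1} :=
      measure_iUnion_fintype_le _ _
    _ = _ := by rw [Finset.sum_congr rfl fun b _ => hlaw b]; simp
  refine measure_mono (Set.compl_subset_comm.1 fun ω hω => ?_)
  have hK : (0 : ℝ) < K := by exact_mod_cast Nat.pos_of_neZero K
  have hdist : ∀ b, 9 / 10 * nstar T ≤ pulls (U T) X ρ (τ T) b ω ∧
      pulls (U T) X ρ (τ T) b ω ≤ 11 / 10 * nstar T := fun b => by
    simp only [Set.mem_compl_iff, Set.mem_iUnion, Set.mem_ofPred_eq, not_exists, not_le] at hω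
    have := hω b
    rw [Real.dist_eq, abs_lt, lt_sub_iff_add_lt, sub_lt_iff_lt_add, lt_div_iff₀ hpos,
      div_lt_iff₀ hpos] at this
    constructor <;> linarith
  have hsum : ∑ b, (pulls (U T) X ρ (τ T) b ω : ℝ) = τ T := by
    exact_mod_cast sum_counts (U T) (rewardTable X ω) (fun s => ρ s ω) (τ T)
  have hlow : K * (9 / 10 * nstar T) ≤ τ T := by
    rw [← hsum]
    simpa using Finset.sum_le_sum fun b (_ : b ∈ Finset.univ) => (hdist b).1
  have hup : τ T ≤ K * (11 / 10 * nstar T) := by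
    rw [← hsum]
    simpa using Finset.sum_le_sum fun b (_ : b ∈ Finset.univ) => (hdist b).2
  have hlow' : 9 / 10 * nstar T ≤ τ T / K := by rwa [le_div_iff₀ hK, mul_comm]
  have hup' : τ T / K ≤ 11 / 10 * nstar T := by rwa [div_le_iff₀ hK, mul_comm]
  intro b
  constructor <;> linarith [(hdist b).1, (hdist b).2]

theorem sampleMean_eq_add {x : ℕ → ℝ} {n : ℕ} (hn : n ≠ 0) (μ : ℝ) :
    sampleMean x n = μ + (∑ i ∈ Finset.range n, (x i - μ)) / n := by
  have : (n : ℝ) ≠ 0 := by exact_mod_cast hn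
  rw [sampleMean, Finset.sum_sub_distrib, Finset.sum_const, Finset.card_range, nsmul_eq_mul]
  field_simp
  ring

/-- A bonus `β / √n` is at most `|β| / √m` in absolute value once `m ≤ n`. -/
theorem abs_div_sqrt_le {m n : ℕ} (hm : 0 < m) (hmn : m ≤ n) (β : ℝ) :
    |β / √(n : ℝ)| ≤ |β| / √(m : ℝ) := by
  have : 0 < √(m : ℝ) := Real.sqrt_pos.2 (by exact_mod_cast hm)
  rw [abs_div, abs_of_nonneg (Real.sqrt_nonneg _)]
  gcongr

/-- If the reward sums of arm `a` are well above and those of the other arms below their means,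
then arm `a` is pulled in all rounds between times `s` and `T`. -/
theorem action_eq_of_sum_bounds {V : IndexRule K} {x : Fin K → ℕ → ℝ}
    {r : ℕ → Equiv.Perm (Fin K)} {s T m A : ℕ} {a : Fin K} {β₁ β₂ μ : ℝ} (hs : K ≤ s) (hm : 0 < m)
    (hA : T ≤ A * m) (hcount : ∀ b, m ≤ counts V x r s b)
    (hmono : ∀ t, s ≤ t → t < T → ∀ b, action V x r t ≠ b →
      armIndex V x r (t + 1) b ≤ armIndex V x r t b)
    (hsand : ∀ t, s ≤ t → t ≤ T → ∀ b,
      armMean V x r t b + β₁ / √(counts V x r t b) ≤ armIndex V x r t b ∧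
      armIndex V x r t b ≤ armMean V x r t b + β₂ / √(counts V x r t b))
    (hhigh : ∀ n ∈ Finset.Icc m (A * m),
      A * (|β₁| + |β₂| + 1) * √m ≤ ∑ i ∈ Finset.range n, (x a i - μ))
    (hlow : ∀ b, b ≠ a → ∀ n ∈ Finset.Icc m (A * m), ∑ i ∈ Finset.range n, (x b i - μ) ≤ 0)
    {t : ℕ} (hst : s ≤ t) (htT : t < T) : action V x r t = a := by
  have hsm : 0 < √(m : ℝ) := Real.sqrt_pos.2 (by exact_mod_cast hm)
  have hmem : ∀ t, s ≤ t → t ≤ T → ∀ b, counts V x r t b ∈ Finset.Icc m (A * m) := fun t hst htT b =>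
    Finset.mem_Icc.2 ⟨(hcount b).trans (counts_mono V x r b hst),
      (counts_le V x r t b).trans (htT.trans hA)⟩
  refine action_eq_of_forall_lt x r hs (z := μ + |β₂| / √m) hmono (fun t hst htT => ?_)
    (fun b hb => ?_) hst htT
  · refine lt_of_lt_of_le ?_ (hsand t hst htT.le a).1
    have hn := hmem t hst htT.le a
    have hn' := Finset.mem_Icc.1 hn
    set n := counts V x r t a with hn_def
    have hn0 : 0 < n := hm.trans_le hn'.1
    have hnR : (0 : ℝ) < n := by exact_mod_cast hn0
    have hnA : (n : ℝ) ≤ A * m := by exact_mod_cast hn'.2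
    rw [armMean, ← hn_def, sampleMean_eq_add hn0.ne' μ]
    -- The factor `A` in the level pays for dividing by `n ≤ A * m`. The term `|β₁|` absorbs the
    -- bonus of `a`, `|β₂|` that of the competitors, and the `1` makes the comparison strict.
    have h1 : (|β₁| + |β₂| + 1) / √m ≤ (∑ i ∈ Finset.range n, (x a i - μ)) / n := by
      rw [le_div_iff₀ hnR]
      refine le_trans ?_ (hhigh n hn)
      rw [div_mul_eq_mul_div, div_le_iff₀ hsm, mul_assoc, Real.mul_self_sqrt (by positivity),
        mul_right_comm, mul_comm]
      gcongr
    have h2 := (abs_le.1 (abs_div_sqrt_le hm hn'.1 β₁)).1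
    rw [add_div, add_div] at h1
    have h3 : 0 < 1 / √(m : ℝ) := by positivity
    linarith
  · have hsT : s ≤ T := by omega
    refine (hsand s le_rfl hsT b).2.trans ?_
    have hn := hmem s le_rfl hsT b
    have hn' := Finset.mem_Icc.1 hn
    set n := counts V x r s b with hn_def
    have hn0 : 0 < n := hm.trans_le hn'.1
    rw [armMean, ← hn_def, sampleMean_eq_add hn0.ne' μ]
    have h1 : (∑ i ∈ Finset.range n, (x b i - μ)) / n ≤ 0 :=
      div_nonpos_of_nonpos_of_nonneg (hlow b hb n hn) (by positivity)
    have h2 := (abs_le.1 (abs_div_sqrt_le hm hn'.1 β₂)).2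
    linarith

/-- The slack between the factors `2 / 3`, `4 / 3` and `1 / 2`, `3 / 2` absorbs the floor in `T / (2
* K)`; for the lower bound this takes exactly `T ≥ 8 * K`. -/
theorem mem_balancedEvent {Ω : Type*} {X : Fin K → ℕ → Ω → ℝ} {ρ : ℕ → Ω → Equiv.Perm (Fin K)}
    {V : IndexRule K} {T : ℕ} (hT : 8 * K ≤ T) {ω : Ω}
    (h : ∀ b, 2 / 3 * (((T / (2 * K) : ℕ) : ℝ) / K) ≤ pulls V X ρ (T / (2 * K)) b ω ∧
      pulls V X ρ (T / (2 * K)) b ω ≤ 4 / 3 * (((T / (2 * K) : ℕ) : ℝ) / K)) :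
    ω ∈ balancedEvent V X ρ T := by
  intro b
  have hK : (0 : ℝ) < K := by exact_mod_cast Nat.pos_of_neZero K
  have hT' : (8 : ℝ) * K ≤ T := by exact_mod_cast hT
  have hle : ((T / (2 * K) : ℕ) : ℝ) * (2 * K) ≤ T := by exact_mod_cast Nat.div_mul_le_self T (2 * K)
  have hge : (T : ℝ) ≤ (((T / (2 * K) : ℕ) : ℝ) + 1) * (2 * K) := by
    have := (Nat.lt_mul_div_succ T (b := 2 * K) (by have := Nat.pos_of_neZero K; omega)).le
    rw [mul_comm] at this
    exact_mod_cast this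
  obtain ⟨h1, h2⟩ := h b
  constructor
  · refine le_trans ?_ h1
    rw [← mul_div_assoc, div_le_div_iff₀ (by positivity) hK]
    nlinarith
  · refine h2.trans ?_
    rw [← mul_div_assoc, div_le_div_iff₀ hK (by positivity)]
    nlinarith

end Bandit

/-! ### Instability. -/

namespace Bandit

variable {Ω : Type*} [MeasurableSpace Ω] {P : Measure Ω} {K : ℕ} {ν : Measure ℝ}
  {X : Fin K → ℕ → Ω → ℝ} {ρ : ℕ → Ω → Equiv.Perm (Fin K)} [NeZero K] {U : ℕ → IndexRule K}

/-- For indices that do not depend on the horizon, stability at the horizon implies stability at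
all times tending to infinity. -/
theorem StableAt.comp (hU : ∀ T T', U T = U T') (h : StableAt P U X ρ fun T => T) {τ : ℕ → ℕ}
    (hτ : Tendsto τ atTop atTop) : StableAt P U X ρ τ := by
  intro a
  obtain ⟨nstar, hconv, hnstar⟩ := h a
  refine ⟨nstar ∘ τ, ?_, hnstar.comp hτ⟩
  have := hconv.comp hτ
  simpa only [Function.comp_def, hU (τ _) 0, hU _ 0] using this

variable [IsProbabilityMeasure P]

/-- If the pull counts are stable at times `⌊T / (2K)⌋`, then with probability bounded away from zero
a given arm is pulled in all later rounds. -/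
theorem StableAt.exists_pos_le_measureReal_forall_arm_eq [IsProbabilityMeasure ν]
    (henv : IsEnvironment P ν X ρ) (hL2 : MemLp id 2 ν) (hvar : 0 < Var[id; ν])
    (hmeas : ∀ T, IsMeasurableRule (U T)) (hsymm : ∀ T, IsSymmetricRule (U T))
    (hmono : ∀ T, IndexNonincreasing P (U T) X ρ T) {β₁ β₂ : ℝ}
    (hsand : ∀ T, 0 < T → IndexSandwiched P (U T) X ρ β₁ β₂ T)
    (hstable : StableAt P U X ρ fun T => T / (2 * K)) (a : Fin K) :
    ∃ p : ℝ, 0 < p ∧ ∀ᶠ T : ℕ in atTop,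
      p ≤ P.real {ω | ∀ t, T / (2 * K) ≤ t → t < T → arm (U T) X ρ t ω = a} := by
  have hK := Nat.pos_of_neZero K
  have hK2 : 0 < 4 * K ^ 2 := by positivity
  -- With `m = T / (4 * K ^ 2) ≥ 1`, rounding costs at most a factor two, so `T ≤ 4 * K ^ 2 * (m +
  -- 1) ≤ A * m`.
  set A := 8 * K ^ 2 with hA
  set μ := ∫ y, y ∂ν
  obtain ⟨p, hp, hev⟩ := henv.exists_pos_le_measureReal_forall_le_sum hL2 hvar
    (s := fun b => if b = a then 1 else -1) (fun b => by split_ifs <;> norm_num)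
    (fun b => if b = a then A * (|β₁| + |β₂| + 1) else 0) A
  have hunbal := hstable.tendsto_measure_unbalanced henv hmeas hsymm
    ((Nat.tendsto_div_const_atTop (by omega : 2 * K ≠ 0)).eventually_ge_atTop K)
  have hhalf : (0 : ℝ≥0∞) < ENNReal.ofReal (p / 2) := by simpa using hp
  have hscale := Nat.tendsto_div_const_atTop hK2.ne'
  refine ⟨p / 2, by positivity, ?_⟩
  filter_upwards [hscale.eventually hev, hscale.eventually_gt_atTop 0,
    hunbal.eventually_lt_const hhalf, eventually_ge_atTop (8 * K),
    (Nat.tendsto_div_const_atTop (by omega : 2 * K ≠ 0)).eventually_ge_atTop K]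
    with T hgood hm hbad hTK hs
  set m := T / (4 * K ^ 2)
  set G := {ω | ∀ b, ∀ n ∈ Finset.Icc m (A * m),
    (if b = a then (A * (|β₁| + |β₂| + 1) : ℝ) else 0) * √m ≤
      ∑ i ∈ Finset.range n, (if b = a then (1 : ℝ) else -1) * (X b i ω - μ)}
  set B := {ω | ∀ b, 2 / 3 * (((T / (2 * K) : ℕ) : ℝ) / K) ≤ pulls (U T) X ρ (T / (2 * K)) b ω ∧
      pulls (U T) X ρ (T / (2 * K)) b ω ≤ 4 / 3 * (((T / (2 * K) : ℕ) : ℝ) / K)}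
  set F := {ω | ∀ t, T / (2 * K) ≤ t → t < T → arm (U T) X ρ t ω = a}
  have hTA : T ≤ A * m := by
    have h1 := (Nat.lt_mul_div_succ T hK2).le
    have h2 : 4 * K ^ 2 * (m + 1) ≤ 4 * K ^ 2 * (2 * m) := Nat.mul_le_mul_left _ (by omega)
    calc T ≤ 4 * K ^ 2 * (m + 1) := h1
      _ ≤ 4 * K ^ 2 * (2 * m) := h2
      _ = A * m := by rw [hA]; ring
  -- Luck `G` and balance `B` need not be independent: `G` has probability at least `p` and `Bᶜ`
  -- eventually less than `p / 2`, so a union bound suffices.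
  have hsub : G ≤ᵐ[P] (F ∪ Bᶜ : Set Ω) := by
    filter_upwards [hmono T, hsand T (by omega)] with ω hωmono hωsand hωG
    by_cases hωB : ω ∈ B
    swap
    · exact Or.inr hωB
    refine Or.inl fun t hst htT => ?_
    have hbal : ω ∈ balancedEvent (U T) X ρ T := mem_balancedEvent hTK hωB
    refine action_eq_of_sum_bounds (β₁ := β₁) (β₂ := β₂) (μ := μ) hs hm hTA (fun b => ?_)
      (fun t hst htT => hωmono t (hs.trans hst) htT) (hωsand hbal) (fun n hn => ?_)
      (fun b hb n hn => ?_) hst htT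
    · have h1 : (m : ℝ) ≤ (T : ℝ) / (4 * (K : ℝ) ^ 2) := by
        refine Nat.cast_div_le.trans (le_of_eq ?_)
        push_cast
        rfl
      exact_mod_cast h1.trans (hbal b).1
    · simpa [rewardTable] using hωG a n hn
    · have := hωG b n hn
      simp only [hb, if_false, zero_mul, neg_one_mul, Finset.sum_neg_distrib] at this
      exact neg_nonneg.1 this
  have hBc : P.real Bᶜ ≤ p / 2 :=
    ENNReal.toReal_le_of_le_ofReal (by positivity) hbad.le
  have hGFB : P.real G ≤ P.real F + P.real Bᶜ :=
    (ENNReal.toReal_mono (measure_ne_top _ _) (measure_mono_ae hsub)).trans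
      (measureReal_union_le F Bᶜ)
  have : p ≤ P.real G := hgood
  linarith

/-- Pull counts cannot be stable both at times `⌊T / (2K)⌋` and at times `T`. -/
theorem not_stableAt_and_stableAt (hK : 2 ≤ K) [IsProbabilityMeasure ν]
    (henv : IsEnvironment P ν X ρ) (hL2 : MemLp id 2 ν) (hvar : 0 < Var[id; ν])
    (hmeas : ∀ T, IsMeasurableRule (U T)) (hsymm : ∀ T, IsSymmetricRule (U T))
    (hmono : ∀ T, IndexNonincreasing P (U T) X ρ T) {β₁ β₂ : ℝ}
    (hsand : ∀ T, 0 < T → IndexSandwiched P (U T) X ρ β₁ β₂ T) :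
    ¬ (StableAt P U X ρ (fun T => T / (2 * K)) ∧ StableAt P U X ρ fun T => T) := by
  rintro ⟨hearly, hlate⟩
  obtain ⟨p, hp, hev⟩ := hearly.exists_pos_le_measureReal_forall_arm_eq henv hL2 hvar hmeas hsymm
    hmono hsand 0
  have hunbal := hlate.tendsto_measure_unbalanced henv hmeas hsymm (eventually_ge_atTop K)
  obtain ⟨T, hT, hbad, hT0⟩ := (hev.and ((hunbal.eventually_lt_const
    (ENNReal.ofReal_pos.2 hp)).and (eventually_gt_atTop 0))).exists
  refine absurd hT (not_le.2 (lt_of_le_of_lt ?_ (ENNReal.toReal_lt_of_lt_ofReal hbad)))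
  -- Lock-in gives arm `0` at least `3 * T / 4` pulls, since `K ≥ 2`; balance at time `T` allows at
  -- most `4 / 3 * (T / K) ≤ 2 * T / 3`.
  refine measureReal_mono fun ω hω hbal => ?_
  have hcount : ∀ t, T / (2 * K) ≤ t → t ≤ T →
      t - T / (2 * K) ≤ counts (U T) (rewardTable X ω) (fun s => ρ s ω) t 0 := by
    intro t hst
    induction t, hst using Nat.le_induction with
    | base => simp
    | succ t hst ih =>
      intro htT
      have h1 := ih (by omega)
      have h2 : action (U T) (rewardTable X ω) (fun s => ρ s ω) t = 0 := hω t hst (by omega)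
      rw [counts_succ, if_pos h2]
      omega
  have hT4 : T / (2 * K) ≤ T / 4 := Nat.div_le_div_left (by omega) (by norm_num)
  have h1 : T - T / 4 ≤ pulls (U T) X ρ T 0 ω :=
    (by omega : T - T / 4 ≤ T - T / (2 * K)).trans (hcount T (Nat.div_le_self _ _) le_rfl)
  have h2 : (3 : ℝ) * T ≤ 4 * (pulls (U T) X ρ T 0 ω) := by
    exact_mod_cast (by omega : 3 * T ≤ 4 * pulls (U T) X ρ T 0 ω)
  have hTR : (0 : ℝ) < T := by exact_mod_cast hT0
  have h3 : (T : ℝ) / K ≤ T / 2 := by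
    gcongr
    exact_mod_cast hK
  have h4 := (hbal 0).2
  linarith

end Bandit

theorem theorem1 {Ω : Type*} [MeasurableSpace Ω] (P : Measure Ω) [IsProbabilityMeasure P]
    (K : ℕ) [NeZero K] (hK : 2 ≤ K)
    (ν : Measure ℝ) [IsProbabilityMeasure ν]
    (hsub : HasSubgaussianMGF (fun x : ℝ => x - ∫ y, y ∂ν) 1 ν)
    (hvar : 0 < Var[fun x : ℝ => x; ν])
    (X : Fin K → ℕ → Ω → ℝ) (ρ : ℕ → Ω → Equiv.Perm (Fin K))
    (henv : Bandit.IsEnvironment P ν X ρ)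
    (U : ℕ → Bandit.IndexRule K)
    (hmeas : ∀ T, Bandit.IsMeasurableRule (U T))
    (hsymm : ∀ T, Bandit.IsSymmetricRule (U T))
    (hmono : ∀ T, Bandit.IndexNonincreasing P (U T) X ρ T)
    (β₁ β₂ : ℝ)
    (hsand : ∀ T, 0 < T → Bandit.IndexSandwiched P (U T) X ρ β₁ β₂ T) :
    ((∀ T T' : ℕ, U T = U T') → ¬ Bandit.StableAt P U X ρ (fun T => T)) ∧
    ¬ (Bandit.StableAt P U X ρ (fun T => T / (2 * K)) ∧
        Bandit.StableAt P U X ρ (fun T => T)) ∧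
    (Bandit.StableAt P U X ρ (fun T => T / (2 * K)) →
      ∀ a : Fin K, ∃ p : ℝ, 0 < p ∧ ∀ᶠ T : ℕ in atTop,
        p ≤ P.real {ω | ∀ t, T / (2 * K) ≤ t → t < T → Bandit.arm (U T) X ρ t ω = a}) := by
  -- Sub-Gaussianity enters only through the finite second moment.
  have hL2 : MemLp id 2 ν := by
    have h := (hsub.memLp 2).add (memLp_const (∫ y, y ∂ν))
    convert h using 1
    · funext x
      simp
    · rfl
  have hboth := Bandit.not_stableAt_and_stableAt hK henv hL2 hvar hmeas hsymm hmono hsand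
  refine ⟨fun hU hlate => hboth ⟨hlate.comp hU ?_, hlate⟩, hboth, fun hearly a =>
    hearly.exists_pos_le_measureReal_forall_arm_eq henv hL2 hvar hmeas hsymm hmono hsand a⟩
  exact Nat.tendsto_div_const_atTop (by omega)
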